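/- Let $k\ge 1$, $\lambda_1,\dots,\lambda_k>0$, $0<\alpha<1$ and $\epsilon>0$. Let $\{M(t)\}_{t\ge0}$ be the generalized counting process (GCP) with rates $\lambda_1,\dots,\lambda_k$, that is, the $\mathbb{N}_0$-valued Lévy process started at $0$ whose transition probabilities satisfy, as $h\to0^+$, $$\Pr\{M(t+h)=n+j\mid M(t)=n\}=\begin{cases}1-\Lambda h+o(h),& j=0,\\ \lambda_j h+o(h),&1\le j\le k,\\ o(h),& j\ge k+1,\end{cases}\qquad \Lambda=\lambda_1+\dots+\lambda_k .$$ Let $\{G_\alpha^{(\epsilon)}(t)\}_{t\ge0}$ be a subordinator (a non-decreasing Lévy process), independent of $\{M(t)\}_{t\ge0}$, with Laplace exponent $\phi^{(\epsilon)}(\eta)=\alpha\epsilon^{-\alpha}\gamma(\alpha;\eta\epsilon)$, i.e. $\mathbb{E}\,e^{-\eta G_\alpha^{(\epsilon)}(t)}=e^{-t\phi^{(\epsilon)}(\eta)}$ for $\eta>0$, $t\ge 0$, where $\gamma(\alpha;\eta)=\int_0^\eta e^{-x}x^{\alpha-1}\,\mathrm{d}x$ is the lower incomplete gamma function. Put $M_\alpha^\epsilon(t)=M(G_\alpha^{(\epsilon)}(t))$.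 Then for every $t\ge0$, $$\Pr\{M_\alpha^\epsilon(t)>y\}\sim\frac{t\,c_1^{\alpha}\,y^{-\alpha}}{\Gamma(1-\alpha)}\qquad\text{as } y\to\infty,\qquad c_1=\sum_{j=1}^k j\lambda_j ,$$ where $f\sim g$ means $f-g=o(g)$ (for $t=0$ both sides are $0$ for $y>0$). -/

import Mathlib

open MeasureTheory ProbabilityTheory Filter Asymptotics Topology
open scoped NNReal

/-- A path is càdlàg: right-continuous on `[0, ∞)` with left limits. -/
def IsCadlagPath (x : ℝ≥0 → ℝ) : Prop :=
  ∀ t : ℝ≥0, ContinuousWithinAt x (Set.Ici t) t ∧ ∃ l : ℝ, Tendsto x (𝓝[<] t) (𝓝 l)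

/-- A real-valued Lévy process: it starts at `0` almost surely, has independent and stationary
increments, and almost surely has càdlàg paths. -/
structure IsLevyProcess {Ω : Type*} [MeasurableSpace Ω]
    (X : ℝ≥0 → Ω → ℝ) (P : Measure Ω) : Prop where
  measurable : ∀ t, Measurable (X t)
  start_zero : ∀ᵐ ω ∂P, X 0 ω = 0
  indep_increments : HasIndepIncrements X P
  stationary_increments : ∀ t h : ℝ≥0,
    IdentDistrib (fun ω => X (t + h) ω - X t ω) (X h) P P
  cadlag : ∀ᵐ ω ∂P, IsCadlagPath (fun t => X t ω)

/-- A generalized counting process with `k` kinds of jumps, of amplitudes `1, …, k` and rates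
`rate 1, …, rate k`: a Lévy process with values in `ℕ` whose transition probabilities over an
infinitesimal interval of length `h` are `1 - Λ h + o(h)` for no jump, `rate j * h + o(h)` for a
jump of size `1 ≤ j ≤ k`, and `o(h)` for a jump of size `j > k`, where `Λ = ∑ rate j`.
Conditioning is on events of positive probability only. -/
structure IsGeneralizedCountingProcess {Ω : Type*} [MeasurableSpace Ω]
    (k : ℕ) (rate : ℕ → ℝ) (M : ℝ≥0 → Ω → ℕ) (P : Measure Ω) : Prop where
  levy : IsLevyProcess (fun t ω => (M t ω : ℝ)) P
  transition_zero : ∀ (t : ℝ≥0) (n : ℕ), P {ω | M t ω = n} ≠ 0 →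
    (fun h : ℝ≥0 => (cond P {ω | M t ω = n}).real {ω | M (t + h) ω = n}
        - (1 - (∑ i ∈ Finset.Icc 1 k, rate i) * (h : ℝ)))
      =o[𝓝[>] (0 : ℝ≥0)] (fun h : ℝ≥0 => (h : ℝ))
  transition_jump : ∀ (t : ℝ≥0) (n j : ℕ), 1 ≤ j → j ≤ k → P {ω | M t ω = n} ≠ 0 →
    (fun h : ℝ≥0 => (cond P {ω | M t ω = n}).real {ω | M (t + h) ω = n + j}
        - rate j * (h : ℝ))
      =o[𝓝[>] (0 : ℝ≥0)] (fun h : ℝ≥0 => (h : ℝ))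
  transition_large : ∀ (t : ℝ≥0) (n j : ℕ), k + 1 ≤ j → P {ω | M t ω = n} ≠ 0 →
    (fun h : ℝ≥0 => (cond P {ω | M t ω = n}).real {ω | M (t + h) ω = n + j})
      =o[𝓝[>] (0 : ℝ≥0)] (fun h : ℝ≥0 => (h : ℝ))

/-- A subordinator: an almost surely non-decreasing Lévy process with values in `[0, ∞)`. -/
structure IsSubordinator {Ω : Type*} [MeasurableSpace Ω]
    (S : ℝ≥0 → Ω → ℝ≥0) (P : Measure Ω) : Prop where
  levy : IsLevyProcess (fun t ω => (S t ω : ℝ)) P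
  mono : ∀ᵐ ω ∂P, Monotone (fun t => S t ω)

/-- `φ` is the Laplace exponent of `S`: `E[exp(-η S(t))] = exp(-t φ(η))` for `η > 0`, `t ≥ 0`. -/
def HasLaplaceExponent {Ω : Type*} [MeasurableSpace Ω]
    (S : ℝ≥0 → Ω → ℝ≥0) (φ : ℝ → ℝ) (P : Measure Ω) : Prop :=
  ∀ (t : ℝ≥0) (η : ℝ), 0 < η →
    ∫ ω, Real.exp (-η * (S t ω : ℝ)) ∂P = Real.exp (-(t : ℝ) * φ η)

/-- The lower incomplete gamma function `γ(a; η) = ∫₀^η e^{-x} x^{a-1} dx`. -/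
noncomputable def lowerIncompleteGamma (a η : ℝ) : ℝ :=
  ∫ x in (0 : ℝ)..η, Real.exp (-x) * x ^ (a - 1)

/-- The incomplete-gamma subordinator `G_α^{(ε)}`: the subordinator with Laplace exponent
`φ(η) = α ε^{-α} γ(α; η ε)`. -/
structure IsIncompleteGammaSubordinator {Ω : Type*} [MeasurableSpace Ω]
    (α ε : ℝ) (G : ℝ≥0 → Ω → ℝ≥0) (P : Measure Ω) : Prop where
  subordinator : IsSubordinator G P
  laplace : HasLaplaceExponent G
    (fun η => α * ε ^ (-α) * lowerIncompleteGamma α (η * ε)) P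

/-- The process `M` run at the random time `G`: `t ↦ M(G(t))`. -/
def timeChange {Ω : Type*} (M : ℝ≥0 → Ω → ℕ) (G : ℝ≥0 → Ω → ℝ≥0) (t : ℝ≥0) (ω : Ω) : ℕ :=
  M (G t ω) ω

/-!
The proof passes through Laplace transforms. Conditioning on `G t`, the variable `M (G t)` has
Laplace transform `exp (-t φ (ψ s))`, where `ψ s = ∑ rate j * (1 - exp (-s j))` is the Laplace
exponent of `M` and `φ` that of `G` (`IsGeneralizedCountingProcess.integral_exp`,
`IsGeneralizedCountingProcess.integral_exp_comp`). As `s → 0+` one has `ψ s ~ c₁ s` and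
`φ η ~ η ^ α`, so that `1 - E exp (-s M (G t)) ~ t c₁ ^ α s ^ α`
(`tendsto_one_sub_exp_div_rpow`). The left side divided by `s` is the Laplace transform of the
tail `y ↦ P (M (G t) > y)` (`integral_exp_mul_measureReal_gt`), hence that transform is
asymptotic to `t c₁ ^ α s ^ (α - 1)`.

The tail is antitone, and a Tauberian theorem of Karamata type
(`tendsto_rpow_mul_of_tendsto_laplace`) turns this into the asymptotics of the tail `F` itself. Its
proof rescales the tail to `f_y x = y ^ α F (x y)`. The hypothesis gives convergence of
`∫ exp (-n x) f_y x` over `x > 0`, as `y → ∞`, for every `n ≥ 1`; the Weierstrass approximation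
theorem in the variable `exp (-x)` extends it to the weights `exp (-x) g (exp (-x))` with `g`
continuous, and testing against weights concentrated just to the left or just to the right of `1`
recovers `f_y 1` by monotonicity.
-/

/-! ### A Tauberian theorem for monotone functions -/

/-- If the integrals of `exp (-x) ^ n` against the densities `exp (-x) * f i x` on `(0, ∞)` converge
for every `n`, so do those of `g (exp (-x))` for continuous `g`: the substitution `u = exp (-x)`
turns this into the moment problem on `[0, 1]`, where polynomials are dense. -/
theorem tendsto_integral_exp_comp_of_tendsto_moments {ι : Type*} {l : Filter ι}
    {f : ι → ℝ → ℝ} {f₀ : ℝ → ℝ}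
    (hf : ∀ᶠ i in l, ∀ x ∈ Set.Ioi (0 : ℝ), 0 ≤ f i x) (hf₀ : ∀ x ∈ Set.Ioi (0 : ℝ), 0 ≤ f₀ x)
    (hint : ∀ᶠ i in l, IntegrableOn (fun x => Real.exp (-x) * f i x) (Set.Ioi 0))
    (hint₀ : IntegrableOn (fun x => Real.exp (-x) * f₀ x) (Set.Ioi 0))
    (hmom : ∀ n : ℕ, Tendsto
      (fun i => ∫ x in Set.Ioi (0 : ℝ), Real.exp (-x) ^ n * (Real.exp (-x) * f i x)) l
      (𝓝 (∫ x in Set.Ioi (0 : ℝ), Real.exp (-x) ^ n * (Real.exp (-x) * f₀ x))))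
    {g : ℝ → ℝ} (hg : Continuous g) :
    Tendsto (fun i => ∫ x in Set.Ioi (0 : ℝ), g (Real.exp (-x)) * (Real.exp (-x) * f i x)) l
      (𝓝 (∫ x in Set.Ioi (0 : ℝ), g (Real.exp (-x)) * (Real.exp (-x) * f₀ x))) := by
  have hmem : ∀ x ∈ Set.Ioi (0 : ℝ), Real.exp (-x) ∈ Set.Icc (0 : ℝ) 1 := fun x hx =>
    ⟨(Real.exp_pos _).le, Real.exp_le_one_iff.2 (by simpa using (Set.mem_Ioi.1 hx).le)⟩
  -- weights that are continuous in `exp (-x)` are bounded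
  have hprod : ∀ {φ h : ℝ → ℝ}, Continuous φ →
      IntegrableOn (fun x => Real.exp (-x) * h x) (Set.Ioi 0) →
      IntegrableOn (fun x => φ (Real.exp (-x)) * (Real.exp (-x) * h x)) (Set.Ioi 0) := by
    intro φ h hφ hh
    obtain ⟨B, hB⟩ := (isCompact_Icc (a := (0 : ℝ)) (b := 1)).exists_bound_of_continuousOn
      hφ.continuousOn
    refine Integrable.bdd_mul (c := B) hh
      (by fun_prop : Continuous fun x => φ (Real.exp (-x))).aestronglyMeasurable ?_
    filter_upwards [ae_restrict_mem measurableSet_Ioi] with x hx using hB _ (hmem x hx)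
  -- uniform approximation of the weight, at a cost proportional to the total mass
  have happrox : ∀ {φ ψ h : ℝ → ℝ} {δ : ℝ}, Continuous φ → Continuous ψ →
      (∀ u ∈ Set.Icc (0 : ℝ) 1, |φ u - ψ u| ≤ δ) →
      (∀ x ∈ Set.Ioi (0 : ℝ), 0 ≤ h x) →
      IntegrableOn (fun x => Real.exp (-x) * h x) (Set.Ioi 0) →
      |(∫ x in Set.Ioi (0 : ℝ), φ (Real.exp (-x)) * (Real.exp (-x) * h x))
        - ∫ x in Set.Ioi (0 : ℝ), ψ (Real.exp (-x)) * (Real.exp (-x) * h x)|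
        ≤ δ * ∫ x in Set.Ioi (0 : ℝ), Real.exp (-x) * h x := by
    intro φ ψ h δ hφ hψ hd h0 hh
    rw [← integral_sub (hprod hφ hh) (hprod hψ hh), ← integral_const_mul, ← Real.norm_eq_abs]
    refine norm_integral_le_of_norm_le (hh.const_mul δ) ?_
    filter_upwards [ae_restrict_mem measurableSet_Ioi] with x hx
    have h1 : 0 ≤ Real.exp (-x) * h x := mul_nonneg (Real.exp_pos _).le (h0 x hx)
    rw [← sub_mul, norm_mul, Real.norm_of_nonneg h1]
    exact mul_le_mul_of_nonneg_right (hd _ (hmem x hx)) h1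
  have hpoly : ∀ p : Polynomial ℝ, Tendsto
      (fun i => ∫ x in Set.Ioi (0 : ℝ), p.eval (Real.exp (-x)) * (Real.exp (-x) * f i x)) l
      (𝓝 (∫ x in Set.Ioi (0 : ℝ), p.eval (Real.exp (-x)) * (Real.exp (-x) * f₀ x))) := by
    have hexpand : ∀ (p : Polynomial ℝ) (h : ℝ → ℝ),
        IntegrableOn (fun x => Real.exp (-x) * h x) (Set.Ioi 0) →
        ∫ x in Set.Ioi (0 : ℝ), p.eval (Real.exp (-x)) * (Real.exp (-x) * h x)
          = ∑ n ∈ Finset.range (p.natDegree + 1), p.coeff n *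
            ∫ x in Set.Ioi (0 : ℝ), Real.exp (-x) ^ n * (Real.exp (-x) * h x) := by
      intro p h hh
      simp_rw [Polynomial.eval_eq_sum_range, Finset.sum_mul, mul_assoc]
      rw [integral_finsetSum]
      · simp_rw [integral_const_mul]
      · intro n _
        exact (hprod (φ := fun u => u ^ n) (by fun_prop) hh).const_mul _
    intro p
    rw [hexpand p f₀ hint₀]
    refine (tendsto_finsetSum _ fun n _ => (hmom n).const_mul (p.coeff n)).congr' ?_
    filter_upwards [hint] with i hi using (hexpand p (f i) hi).symm
  set A := ∫ x in Set.Ioi (0 : ℝ), Real.exp (-x) * f₀ x with hA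
  have hA0 : 0 ≤ A := setIntegral_nonneg measurableSet_Ioi fun x hx =>
    mul_nonneg (Real.exp_pos _).le (hf₀ x hx)
  have hmass : ∀ᶠ i in l, ∫ x in Set.Ioi (0 : ℝ), Real.exp (-x) * f i x < A + 1 := by
    have := hmom 0
    simp only [pow_zero, one_mul] at this
    exact this.eventually_lt_const (lt_add_one _)
  rw [Metric.tendsto_nhds]
  intro η hη
  -- three errors add up: `δ (A + 1)` and `δ A` from replacing `g` by a polynomial, and `δ` from
  -- the convergence for that polynomial
  set δ := η / (2 * A + 3) with hδ
  have hδ0 : 0 < δ := by positivity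
  obtain ⟨p, hp⟩ := exists_polynomial_near_of_continuousOn 0 1 g hg.continuousOn δ hδ0
  have hp' : ∀ u ∈ Set.Icc (0 : ℝ) 1, |g u - p.eval u| ≤ δ := fun u hu => by
    rw [abs_sub_comm]; exact (hp u hu).le
  filter_upwards [hf, hint, hmass, (Metric.tendsto_nhds.1 (hpoly p)) δ hδ0] with i h1 h2 h3 h4
  have h5 := happrox hg p.continuous hp' h1 h2
  have h6 := happrox hg p.continuous hp' hf₀ hint₀
  rw [Real.dist_eq] at h4 ⊢
  have h7 : δ * (∫ x in Set.Ioi (0 : ℝ), Real.exp (-x) * f i x) ≤ δ * (A + 1) :=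
    mul_le_mul_of_nonneg_left h3.le hδ0.le
  have h8 : η = δ * (2 * A + 3) := by rw [hδ]; field_simp
  rw [abs_le] at h5 h6
  rw [abs_lt] at h4 ⊢
  constructor <;> nlinarith

/-- A continuous weight `g (exp (-x))` concentrated on `(a, b)`. Integrating an antitone function
against `g (exp (-x)) * exp (-x)` gives a value between `W` times those at `b` and at `a`, where
`W` is the total mass of `g (exp (-x)) * exp (-x)` on `(0, ∞)`. -/
theorem exists_continuous_weight {a b : ℝ} (ha : 0 < a) (hab : a < b) :
    ∃ g : ℝ → ℝ, Continuous g ∧ ∃ W : ℝ, 0 < W ∧ ∀ h : ℝ → ℝ, AntitoneOn h (Set.Ioi 0) →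
      IntegrableOn (fun x => Real.exp (-x) * h x) (Set.Ioi 0) →
      W * h b ≤ ∫ x in Set.Ioi (0 : ℝ), g (Real.exp (-x)) * (Real.exp (-x) * h x) ∧
      ∫ x in Set.Ioi (0 : ℝ), g (Real.exp (-x)) * (Real.exp (-x) * h x) ≤ W * h a := by
  set g : ℝ → ℝ := fun u => max 0 (min (u - Real.exp (-b)) (Real.exp (-a) - u)) with hgdef
  have hgc : Continuous g := by fun_prop
  have hg0 : ∀ u, 0 ≤ g u := fun u => le_max_left _ _
  have hg1 : ∀ u, u ≤ 1 → g u ≤ 1 := fun u hu =>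
    max_le zero_le_one ((min_le_left _ _).trans (by linarith [Real.exp_pos (-b)]))
  have hsupp : ∀ x, x ≤ a ∨ b ≤ x → g (Real.exp (-x)) = 0 := by
    rintro x (hx | hx)
    · have := Real.exp_le_exp.2 (neg_le_neg hx)
      exact max_eq_left ((min_le_right _ _).trans (by linarith))
    · have := Real.exp_le_exp.2 (neg_le_neg hx)
      exact max_eq_left ((min_le_left _ _).trans (by linarith))
  have hpos : ∀ x, a < x → x < b → 0 < g (Real.exp (-x)) := fun x h1 h2 => by
    have h3 := Real.exp_lt_exp.2 (neg_lt_neg h1)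
    have h4 := Real.exp_lt_exp.2 (neg_lt_neg h2)
    exact lt_max_of_lt_right (lt_min (by linarith) (by linarith))
  have hmul : ∀ {h : ℝ → ℝ}, IntegrableOn (fun x => Real.exp (-x) * h x) (Set.Ioi 0) →
      IntegrableOn (fun x => g (Real.exp (-x)) * (Real.exp (-x) * h x)) (Set.Ioi 0) := by
    intro h hh
    refine Integrable.bdd_mul (c := 1) hh
      (by fun_prop : Continuous fun x => g (Real.exp (-x))).aestronglyMeasurable ?_
    filter_upwards [ae_restrict_mem measurableSet_Ioi] with x hx
    rw [Real.norm_of_nonneg (hg0 _)]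
    exact hg1 _ (Real.exp_le_one_iff.2 (by simpa using (Set.mem_Ioi.1 hx).le))
  have hw : IntegrableOn (fun x => g (Real.exp (-x)) * (Real.exp (-x) * 1)) (Set.Ioi 0) :=
    hmul (h := fun _ => 1) (by simpa using integrableOn_exp_neg_Ioi 0)
  have hwc : ∀ c : ℝ, (∫ x in Set.Ioi (0 : ℝ), g (Real.exp (-x)) * (Real.exp (-x) * 1)) * c
      = ∫ x in Set.Ioi (0 : ℝ), g (Real.exp (-x)) * (Real.exp (-x) * c) := fun c => by
    rw [← integral_mul_const]; simp [mul_assoc]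
  have hwi : ∀ c : ℝ,
      IntegrableOn (fun x => g (Real.exp (-x)) * (Real.exp (-x) * c)) (Set.Ioi 0) := fun c =>
    hmul (h := fun _ => c) ((integrableOn_exp_neg_Ioi 0).mul_const c)
  refine ⟨g, hgc, ∫ x in Set.Ioi (0 : ℝ), g (Real.exp (-x)) * (Real.exp (-x) * 1), ?_, ?_⟩
  · rw [setIntegral_pos_iff_support_of_nonneg_ae
      (ae_of_all _ fun x => mul_nonneg (hg0 _) (by positivity)) hw]
    refine lt_of_lt_of_le ?_ (measure_mono (s := Set.Ioo a b) ?_)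
    · simpa using hab
    · intro x hx
      refine ⟨?_, ha.trans hx.1⟩
      have := hpos x hx.1 hx.2
      have h2 := Real.exp_pos (-x)
      simp only [Function.mem_support]
      positivity
  · intro h hh hhi
    rw [hwc, hwc]
    constructor
    · refine setIntegral_mono_on (hwi _) (hmul hhi) measurableSet_Ioi fun x hx => ?_
      by_cases hx' : x ≤ a ∨ b ≤ x
      · simp [hsupp x hx']
      · push Not at hx'
        exact mul_le_mul_of_nonneg_left (mul_le_mul_of_nonneg_left
          (hh hx (ha.trans hab) hx'.2.le) (Real.exp_pos _).le) (hg0 _)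
    · refine setIntegral_mono_on (hmul hhi) (hwi _) measurableSet_Ioi fun x hx => ?_
      by_cases hx' : x ≤ a ∨ b ≤ x
      · simp [hsupp x hx']
      · push Not at hx'
        exact mul_le_mul_of_nonneg_left (mul_le_mul_of_nonneg_left
          (hh ha hx hx'.1.le) (Real.exp_pos _).le) (hg0 _)

/-- Karamata's Tauberian theorem combined with the monotone density theorem: if `F` is nonnegative
and antitone and its Laplace transform is asymptotic to `C s ^ (-ρ)` at `0+`, then `F y` is
asymptotic to `C / Γ(ρ) * y ^ (ρ - 1)` at infinity. For `C = 0` the relations are `o`-estimates. -/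
theorem tendsto_rpow_mul_of_tendsto_laplace {F : ℝ → ℝ} {ρ C : ℝ} (hρ : 0 < ρ) (hρ1 : ρ ≤ 1)
    (hF0 : ∀ x ∈ Set.Ioi (0 : ℝ), 0 ≤ F x) (hF : AntitoneOn F (Set.Ioi 0))
    (hint : ∀ s : ℝ, 0 < s → IntegrableOn (fun x => Real.exp (-(s * x)) * F x) (Set.Ioi 0))
    (hlim : Tendsto (fun s : ℝ => s ^ ρ * ∫ x in Set.Ioi (0 : ℝ), Real.exp (-(s * x)) * F x)
      (𝓝[>] 0) (𝓝 C)) :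
    Tendsto (fun y : ℝ => y ^ (1 - ρ) * F y) atTop (𝓝 (C / Real.Gamma ρ)) := by
  have hΓ : 0 < Real.Gamma ρ := Real.Gamma_pos_of_pos hρ
  have hC : 0 ≤ C := by
    refine ge_of_tendsto hlim ?_
    filter_upwards [self_mem_nhdsWithin] with s hs
    exact mul_nonneg (Real.rpow_nonneg (Set.mem_Ioi.1 hs).le _)
      (setIntegral_nonneg measurableSet_Ioi fun x hx => mul_nonneg (Real.exp_pos _).le (hF0 x hx))
  set D := C / Real.Gamma ρ with hD
  have hD0 : 0 ≤ D := div_nonneg hC hΓ.le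
  -- the rescaled functions, whose exponential moments converge to those of `D x ^ (ρ - 1)`
  set f : ℝ → ℝ → ℝ := fun y x => y ^ (1 - ρ) * F (x * y) with hf
  set f₀ : ℝ → ℝ := fun x => D * x ^ (ρ - 1) with hf₀
  have hf₀anti : AntitoneOn f₀ (Set.Ioi 0) := fun x hx y _ hxy =>
    mul_le_mul_of_nonneg_left (Real.rpow_le_rpow_of_nonpos hx hxy (by linarith)) hD0
  have hfanti : ∀ y : ℝ, 0 < y → AntitoneOn (f y) (Set.Ioi 0) := fun y hy u hu v hv huv =>
    mul_le_mul_of_nonneg_left (hF (mul_pos hu hy) (mul_pos hv hy)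
      (mul_le_mul_of_nonneg_right huv hy.le)) (Real.rpow_nonneg hy.le _)
  have hfint : ∀ y : ℝ, 0 < y →
      IntegrableOn (fun x => Real.exp (-x) * f y x) (Set.Ioi 0) := by
    intro y hy
    have h1 := (integrableOn_Ioi_comp_mul_right_iff
      (fun u => Real.exp (-(y⁻¹ * u)) * F u) 0 hy).2 (by simpa using hint y⁻¹ (by positivity))
    refine (h1.const_mul (y ^ (1 - ρ))).congr (ae_of_all _ fun x => ?_)
    have : y⁻¹ * (x * y) = x := by field_simp
    simp only [hf, this]; ring
  have hf₀val : ∀ n : ℕ, ∫ x in Set.Ioi (0 : ℝ), Real.exp (-x) ^ n * (Real.exp (-x) * f₀ x)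
      = C * ((n : ℝ) + 1) ^ (-ρ) := by
    intro n
    have h1 := Real.integral_rpow_mul_exp_neg_mul_Ioi hρ (by positivity : (0 : ℝ) < n + 1)
    have h2 : ∀ x : ℝ, Real.exp (-x) ^ n * (Real.exp (-x) * f₀ x)
        = D * (x ^ (ρ - 1) * Real.exp (-((n + 1) * x))) := fun x => by
      rw [show -(((n : ℝ) + 1) * x) = n * (-x) + -x by ring, Real.exp_add, Real.exp_nat_mul]
      ring
    simp_rw [h2]
    rw [integral_const_mul, h1, hD, one_div, Real.inv_rpow (by positivity),
      Real.rpow_neg (by positivity)]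
    field_simp
  have hf₀int : IntegrableOn (fun x => Real.exp (-x) * f₀ x) (Set.Ioi 0) :=
    ((Real.GammaIntegral_convergent hρ).const_mul D).congr (ae_of_all _ fun x => by
      simp only [hf₀]; ring)
  have hconv : ∀ {g : ℝ → ℝ}, Continuous g → Tendsto
      (fun y => ∫ x in Set.Ioi (0 : ℝ), g (Real.exp (-x)) * (Real.exp (-x) * f y x)) atTop
      (𝓝 (∫ x in Set.Ioi (0 : ℝ), g (Real.exp (-x)) * (Real.exp (-x) * f₀ x))) := by
    refine tendsto_integral_exp_comp_of_tendsto_moments ?_ ?_ ?_ hf₀int ?_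
    · filter_upwards [eventually_gt_atTop 0] with y hy x hx
      exact mul_nonneg (Real.rpow_nonneg hy.le _) (hF0 _ (mul_pos hx hy))
    · exact fun x hx => mul_nonneg hD0 (Real.rpow_nonneg (Set.mem_Ioi.1 hx).le _)
    · filter_upwards [eventually_gt_atTop 0] with y hy using hfint y hy
    · intro n
      rw [hf₀val]
      have h1 : Tendsto (fun y : ℝ => ((n : ℝ) + 1) / y) atTop (𝓝[>] 0) :=
        tendsto_nhdsWithin_iff.2 ⟨tendsto_const_nhds.div_atTop tendsto_id, by
          filter_upwards [eventually_gt_atTop 0] with y hy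
          exact div_pos (by positivity) hy⟩
      refine ((hlim.comp h1).mul_const (((n : ℝ) + 1) ^ (-ρ))).congr' ?_
      filter_upwards [eventually_gt_atTop 0] with y hy
      have h2 := integral_comp_mul_right_Ioi
        (fun u => Real.exp (-((n + 1) / y * u)) * F u) 0 hy
      have h3 : ∀ x : ℝ, Real.exp (-x) ^ n * (Real.exp (-x) * f y x)
          = y ^ (1 - ρ) * (Real.exp (-((n + 1) / y * (x * y))) * F (x * y)) := fun x => by
        rw [show -(((n : ℝ) + 1) / y * (x * y)) = n * (-x) + -x by field_simp; ring,
          Real.exp_add, Real.exp_nat_mul]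
        simp only [hf]; ring
      simp_rw [h3]
      rw [integral_const_mul, h2, zero_mul]
      simp only [Function.comp, smul_eq_mul]
      rw [Real.div_rpow (by positivity) hy.le, Real.rpow_neg (by positivity),
        Real.rpow_sub hy, Real.rpow_one]
      have h4 : (0 : ℝ) < ((n : ℝ) + 1) ^ ρ := by positivity
      field_simp
  have hf1 : ∀ y, y ^ (1 - ρ) * F y = f y 1 := fun y => by simp [hf]
  simp_rw [hf1]
  have hf₀1 : f₀ 1 = D := by simp [hf₀]
  have hf₀c : ContinuousAt f₀ 1 :=
    (Real.continuousAt_rpow_const 1 (ρ - 1) (Or.inl one_ne_zero)).const_mul D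
  -- lower bounds come from weights to the right of `1`, upper bounds from weights to its left
  rw [tendsto_order]
  constructor
  · intro d hd
    rw [← hf₀1] at hd
    obtain ⟨c, hc, hc1⟩ : ∃ c, d < f₀ c ∧ 1 < c :=
      (((hf₀c.tendsto.mono_left nhdsWithin_le_nhds).eventually_const_lt hd).and
        (self_mem_nhdsWithin (s := Set.Ioi (1 : ℝ)))).exists
    obtain ⟨g, hg, W, hW, hgW⟩ := exists_continuous_weight one_pos hc1
    have h1 := (hgW f₀ hf₀anti hf₀int).1
    filter_upwards [(hconv hg).eventually_const_lt
      ((mul_lt_mul_of_pos_left hc hW).trans_le h1), eventually_gt_atTop 0] with y hy hy0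
    exact lt_of_mul_lt_mul_left (hy.trans_le (hgW (f y) (hfanti y hy0) (hfint y hy0)).2) hW.le
  · intro d hd
    rw [← hf₀1] at hd
    obtain ⟨c, ⟨hc, hc0⟩, hc1⟩ : ∃ c, (f₀ c < d ∧ 0 < c) ∧ c < 1 :=
      ((((hf₀c.tendsto.mono_left nhdsWithin_le_nhds).eventually_lt_const hd).and
        (nhdsWithin_le_nhds (lt_mem_nhds one_pos))).and
        (self_mem_nhdsWithin (s := Set.Iio (1 : ℝ)))).exists
    obtain ⟨g, hg, W, hW, hgW⟩ := exists_continuous_weight hc0 hc1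
    have h1 := (hgW f₀ hf₀anti hf₀int).2
    filter_upwards [(hconv hg).eventually_lt_const
      (h1.trans_lt (mul_lt_mul_of_pos_left hc hW)), eventually_gt_atTop 0] with y hy hy0
    exact lt_of_mul_lt_mul_left ((hgW (f y) (hfanti y hy0) (hfint y hy0)).1.trans_lt hy) hW.le

/-! ### Laplace transforms of tails and of Lévy processes -/

/-- The Laplace transform of the tail of a nonnegative random variable, by the layer cake
formula. -/
theorem integral_exp_mul_measureReal_gt {Ω : Type*} [MeasurableSpace Ω] {P : Measure Ω}
    [IsProbabilityMeasure P] {X : Ω → ℝ} (hX : AEMeasurable X P) (hX0 : ∀ ω, 0 ≤ X ω)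
    {s : ℝ} (hs : 0 < s) :
    ∫ x in Set.Ioi (0 : ℝ), Real.exp (-(s * x)) * P.real {ω | x < X ω}
      = (1 - ∫ ω, Real.exp (-s * X ω) ∂P) / s := by
  have hprim : ∀ y : ℝ, ∫ x in (0 : ℝ)..y, Real.exp (-(s * x)) = (1 - Real.exp (-s * y)) / s := by
    intro y
    have h1 : ∀ x ∈ Set.uIcc 0 y,
        HasDerivAt (fun x => -Real.exp (-s * x) / s) (Real.exp (-(s * x))) x := fun x _ => by
      have h2 := ((((hasDerivAt_id x).const_mul (-s)).exp).neg).div_const s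
      refine h2.congr_deriv ?_
      simp only [id]
      field_simp
    rw [intervalIntegral.integral_eq_sub_of_hasDerivAt h1
      (Continuous.intervalIntegrable (by fun_prop) _ _)]
    simp only [mul_zero, Real.exp_zero]
    ring
  have hlc := lintegral_comp_eq_lintegral_meas_lt_mul P (f := X)
    (g := fun x => Real.exp (-(s * x))) (ae_of_all _ hX0) hX
    (fun t _ => (by fun_prop : Continuous fun x => Real.exp (-(s * x))).intervalIntegrable _ _)
    (ae_of_all _ fun x => (Real.exp_pos _).le)
  have hanti : Antitone fun x : ℝ => P.real {ω | x < X ω} := fun a b hab =>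
    measureReal_mono fun ω (hω : b < X ω) => hab.trans_lt hω
  have hle : ∀ ω, Real.exp (-s * X ω) ≤ 1 := fun ω =>
    Real.exp_le_one_iff.2 (by nlinarith [hX0 ω])
  have hint : Integrable (fun ω => Real.exp (-s * X ω)) P := by
    refine Integrable.of_bound (by fun_prop) 1 (ae_of_all _ fun ω => ?_)
    rw [Real.norm_of_nonneg (Real.exp_pos _).le]
    exact hle ω
  rw [integral_eq_lintegral_of_nonneg_ae
    (ae_of_all _ fun x => mul_nonneg (Real.exp_pos _).le measureReal_nonneg)
    ((by fun_prop : Continuous fun x => Real.exp (-(s * x))).measurable.mul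
      hanti.measurable).aestronglyMeasurable]
  have h3 : (1 - ∫ ω, Real.exp (-s * X ω) ∂P) / s
      = ∫ ω, (∫ x in (0 : ℝ)..X ω, Real.exp (-(s * x))) ∂P := by
    simp_rw [hprim]
    rw [integral_div, integral_sub (integrable_const _) hint]
    simp
  rw [h3, integral_eq_lintegral_of_nonneg_ae, hlc]
  · congr 1
    refine lintegral_congr fun x => ?_
    rw [ENNReal.ofReal_mul (Real.exp_pos _).le, mul_comm, ofReal_measureReal]
  · exact ae_of_all _ fun ω => intervalIntegral.integral_nonneg (hX0 ω)
      fun x _ => (Real.exp_pos _).le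
  · simp_rw [hprim]
    exact (((integrable_const 1).sub hint).div_const s).1

theorem IsLevyProcess.mgf_add {Ω : Type*} [MeasurableSpace Ω] {P : Measure Ω}
    {X : ℝ≥0 → Ω → ℝ} (hX : IsLevyProcess X P) (u : ℝ) (t h : ℝ≥0) :
    mgf (X (t + h)) P u = mgf (X t) P u * mgf (X h) P u := by
  have h1 : X t ⟂ᵢ[P] (X (t + h) - X t) :=
    hX.indep_increments.indepFun_eval_sub (zero_le (a := t)) le_self_add hX.start_zero
  have h2 : mgf (X (t + h) - X t) P u = mgf (X h) P u :=
    mgf_congr_of_identDistrib _ _ (hX.stationary_increments t h) u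
  have h3 := h1.mgf_add
    ((by have := hX.measurable t; fun_prop :
      Measurable fun ω => Real.exp (u * X t ω)).aestronglyMeasurable)
    ((by have := hX.measurable t; have := hX.measurable (t + h); fun_prop :
      Measurable fun ω => Real.exp (u * (X (t + h) - X t) ω)).aestronglyMeasurable)
  rw [← h2, ← h3, add_sub_cancel]

/-! ### The Laplace transform of a generalized counting process -/

theorem IsGeneralizedCountingProcess.measurable {Ω : Type*} [MeasurableSpace Ω]
    {P : Measure Ω} {k : ℕ} {rate : ℕ → ℝ} {M : ℝ≥0 → Ω → ℕ}
    (hM : IsGeneralizedCountingProcess k rate M P) (t : ℝ≥0) : Measurable (M t) := by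
  have h1 := Nat.measurable_floor.comp (hM.levy.measurable t)
  have h2 : (Nat.floor ∘ fun ω => (M t ω : ℝ)) = M t := by
    ext ω; simp
  rwa [h2] at h1

/-- The Laplace exponent `∑ rate j * (1 - exp (-s j))`, `1 ≤ j ≤ k`, of the generalized counting
process with jump rates `rate j`. -/
noncomputable def gcpLaplaceExponent (k : ℕ) (rate : ℕ → ℝ) (s : ℝ) : ℝ :=
  ∑ j ∈ Finset.Icc 1 k, rate j * (1 - Real.exp (-s * j))

/-- The Laplace transform of `M h` has right derivative `-gcpLaplaceExponent k rate s` in `h` at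
`0`. Jumps above `k` contribute only `o(h)` in total, since the probabilities of the values
`0, …, k` already add up to `1 + o(h)`. -/
theorem IsGeneralizedCountingProcess.mgf_isLittleO {Ω : Type*} [MeasurableSpace Ω]
    {P : Measure Ω} [IsProbabilityMeasure P] {k : ℕ} {rate : ℕ → ℝ} {M : ℝ≥0 → Ω → ℕ}
    (hM : IsGeneralizedCountingProcess k rate M P) {s : ℝ} (hs : 0 ≤ s) :
    (fun h : ℝ≥0 => mgf (fun ω => (M h ω : ℝ)) P (-s) - 1
        + gcpLaplaceExponent k rate s * (h : ℝ))
      =o[𝓝[>] (0 : ℝ≥0)] (fun h : ℝ≥0 => (h : ℝ)) := by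
  have hmeas := hM.measurable
  have hstart : ∀ᵐ ω ∂P, M 0 ω = 0 := by
    filter_upwards [hM.levy.start_zero] with ω hω using by exact_mod_cast hω
  have hone : P {ω | M 0 ω = 0} = 1 :=
    (prob_compl_eq_zero_iff (hmeas 0 (measurableSet_singleton 0))).1 hstart
  have hcond : cond P {ω | M 0 ω = 0} = P := by
    rw [ProbabilityTheory.cond, hone, inv_one, one_smul]
    exact Measure.restrict_eq_self_of_ae_mem hstart
  set p : ℕ → ℝ≥0 → ℝ := fun j h => P.real {ω | M h ω = j} with hp
  set Λ := ∑ i ∈ Finset.Icc 1 k, rate i with hΛ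
  have he0 : (fun h : ℝ≥0 => p 0 h - (1 - Λ * (h : ℝ))) =o[𝓝[>] (0 : ℝ≥0)]
      (fun h : ℝ≥0 => (h : ℝ)) := by
    simpa only [hcond, zero_add] using hM.transition_zero 0 0 (by simp [hone])
  have hej : ∀ j ∈ Finset.Icc 1 k, (fun h : ℝ≥0 => p j h - rate j * (h : ℝ))
      =o[𝓝[>] (0 : ℝ≥0)] (fun h : ℝ≥0 => (h : ℝ)) := fun j hj => by
    have := hM.transition_jump 0 0 j (Finset.mem_Icc.1 hj).1 (Finset.mem_Icc.1 hj).2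
      (by simp [hone])
    simpa only [hcond, zero_add] using this
  -- the contribution of the values above `k`
  set r : ℝ≥0 → ℝ := fun h =>
    ∫ ω, Set.indicator {m : ℕ | k < m} (fun m => Real.exp (-s * (m : ℝ))) (M h ω) ∂P with hr
  have hbdd : ∀ (φ : ℕ → ℝ), (∀ m, |φ m| ≤ 1) → ∀ h, Integrable (fun ω => φ (M h ω)) P :=
    fun φ hφ h => Integrable.of_bound
      ((measurable_of_countable φ).comp (hmeas h)).aestronglyMeasurable 1
      (ae_of_all _ fun ω => hφ _)
  have hexp1 : ∀ m : ℕ, Real.exp (-s * m) ≤ 1 := fun m =>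
    Real.exp_le_one_iff.2 (by have := Nat.cast_nonneg (α := ℝ) m; nlinarith)
  have hpint : ∀ j h, ∫ ω, Set.indicator {j} (fun _ => (1 : ℝ)) (M h ω) ∂P = p j h := by
    intro j h
    have : (fun ω => Set.indicator {j} (fun _ => (1 : ℝ)) (M h ω))
        = Set.indicator {ω | M h ω = j} 1 := by
      ext ω; simp [Set.indicator_apply]
    rw [this]
    exact integral_indicator_one (hmeas h (measurableSet_singleton j))
  -- splitting an expectation according to the values `0`, `1, …, k` and above `k`
  have hsplit : ∀ (φ : ℕ → ℝ), (∀ m, |φ m| ≤ 1) → ∀ h, ∫ ω, φ (M h ω) ∂P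
      = φ 0 * p 0 h + ∑ j ∈ Finset.Icc 1 k, φ j * p j h
        + ∫ ω, Set.indicator {m : ℕ | k < m} φ (M h ω) ∂P := by
    intro φ hφ h
    have hpt : ∀ m : ℕ, φ m = φ 0 * Set.indicator {0} (fun _ => (1 : ℝ)) m
        + ∑ j ∈ Finset.Icc 1 k, φ j * Set.indicator {j} (fun _ => (1 : ℝ)) m
        + Set.indicator {m : ℕ | k < m} φ m := by
      intro m
      simp only [Set.indicator_apply, Set.mem_singleton_iff, mul_ite, mul_one, mul_zero,
        Finset.sum_ite_eq, Finset.mem_Icc, Set.mem_ofPred_eq]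
      rcases Nat.eq_zero_or_pos m with rfl | hm
      · simp
      · rcases le_or_gt m k with h1 | h1
        · simp [hm.ne', Nat.one_le_iff_ne_zero, h1, h1.not_gt]
        · simp [hm.ne', h1.not_ge, h1]
    have hi1 : ∀ j, Integrable (fun ω => Set.indicator {j} (fun _ => (1 : ℝ)) (M h ω)) P :=
      fun j => hbdd _ (fun m => by
        rw [Set.indicator_apply]; split_ifs <;> simp) h
    have hi2 : Integrable (fun ω => Set.indicator {m : ℕ | k < m} φ (M h ω)) P :=
      hbdd _ (fun m => by rw [Set.indicator_apply]; split_ifs <;> simp [hφ]) h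
    have hi3 : Integrable (fun ω => ∑ j ∈ Finset.Icc 1 k,
        φ j * Set.indicator {j} (fun _ => (1 : ℝ)) (M h ω)) P :=
      integrable_finsetSum _ fun j _ => (hi1 j).const_mul _
    have hi4 : Integrable (fun ω => φ 0 * Set.indicator {0} (fun _ => (1 : ℝ)) (M h ω)
        + ∑ j ∈ Finset.Icc 1 k, φ j * Set.indicator {j} (fun _ => (1 : ℝ)) (M h ω)) P :=
      ((hi1 0).const_mul _).add hi3
    rw [integral_congr_ae (ae_of_all P fun ω => hpt (M h ω)), integral_add hi4 hi2,
      integral_add ((hi1 0).const_mul _) hi3,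
      integral_const_mul, integral_finsetSum _ fun j _ => (hi1 j).const_mul _]
    simp_rw [integral_const_mul, hpint]
  have hmgf : ∀ h, mgf (fun ω => (M h ω : ℝ)) P (-s)
      = p 0 h + ∑ j ∈ Finset.Icc 1 k, Real.exp (-s * j) * p j h + r h := fun h => by
    have := hsplit (fun m => Real.exp (-s * m)) (fun m => by
      rw [abs_of_pos (Real.exp_pos _)]; exact hexp1 m) h
    simpa [mgf, hr] using this
  have hsum : (fun h : ℝ≥0 => (p 0 h - (1 - Λ * (h : ℝ)))
      + ∑ j ∈ Finset.Icc 1 k, (p j h - rate j * (h : ℝ))) =o[𝓝[>] (0 : ℝ≥0)]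
      (fun h : ℝ≥0 => (h : ℝ)) := he0.add (IsLittleO.fun_sum hej)
  have hrO : r =o[𝓝[>] (0 : ℝ≥0)] (fun h : ℝ≥0 => (h : ℝ)) := by
    refine (IsBigO.of_bound 1 (Eventually.of_forall fun h => ?_)).trans_isLittleO hsum
    have h1 := hsplit (fun _ => 1) (fun m => by simp) h
    have h2 : 0 ≤ r h := integral_nonneg fun ω =>
      Set.indicator_nonneg (fun _ _ => (Real.exp_pos _).le) _
    have h3 : r h ≤ ∫ ω, Set.indicator {m : ℕ | k < m} (fun _ => (1 : ℝ)) (M h ω) ∂P := by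
      refine integral_mono (hbdd _ (fun m => ?_) h) (hbdd _ (fun m => ?_) h) fun ω => ?_
      · rw [Set.indicator_apply]; split_ifs
        · rw [abs_of_pos (Real.exp_pos _)]; exact hexp1 m
        · simp
      · rw [Set.indicator_apply]; split_ifs <;> simp
      · exact Set.indicator_le_indicator (hexp1 _)
    have h4 : (p 0 h - (1 - Λ * (h : ℝ))) + ∑ j ∈ Finset.Icc 1 k, (p j h - rate j * (h : ℝ))
        = -∫ ω, Set.indicator {m : ℕ | k < m} (fun _ => (1 : ℝ)) (M h ω) ∂P := by
      rw [Finset.sum_sub_distrib, ← Finset.sum_mul, ← hΛ]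
      simp only [one_mul, integral_const, probReal_univ, smul_eq_mul, mul_one] at h1
      linarith
    rw [h4, norm_neg, one_mul, Real.norm_of_nonneg h2]
    exact h3.trans (le_abs_self _)
  have hwsum : (fun h : ℝ≥0 => (p 0 h - (1 - Λ * (h : ℝ)))
      + ∑ j ∈ Finset.Icc 1 k, Real.exp (-s * j) * (p j h - rate j * (h : ℝ)) + r h)
      =o[𝓝[>] (0 : ℝ≥0)] (fun h : ℝ≥0 => (h : ℝ)) :=
    (he0.add (IsLittleO.fun_sum fun j hj => (hej j hj).const_mul_left _)).add hrO
  refine hwsum.congr_left fun h => ?_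
  have h5 : gcpLaplaceExponent k rate s * (h : ℝ)
      = Λ * (h : ℝ) - ∑ j ∈ Finset.Icc 1 k, Real.exp (-s * j) * (rate j * (h : ℝ)) := by
    rw [gcpLaplaceExponent, hΛ, Finset.sum_mul, Finset.sum_mul, ← Finset.sum_sub_distrib]
    exact Finset.sum_congr rfl fun j _ => by ring
  simp_rw [hmgf, h5, mul_sub, Finset.sum_sub_distrib]
  ring

/-- The Laplace transform of `M t` is multiplicative in `t`, hence equals the `n`-th power of its
value at `t / n`, which tends to an exponential by the expansion at `0`. -/
theorem IsGeneralizedCountingProcess.integral_exp {Ω : Type*} [MeasurableSpace Ω]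
    {P : Measure Ω} [IsProbabilityMeasure P] {k : ℕ} {rate : ℕ → ℝ} {M : ℝ≥0 → Ω → ℕ}
    (hM : IsGeneralizedCountingProcess k rate M P) {s : ℝ} (hs : 0 ≤ s) (t : ℝ≥0) :
    ∫ ω, Real.exp (-s * (M t ω : ℝ)) ∂P
      = Real.exp (-gcpLaplaceExponent k rate s * (t : ℝ)) := by
  obtain ⟨g, hg⟩ : ∃ g : ℝ≥0 → ℝ, ∀ t, g t = mgf (fun ω => (M t ω : ℝ)) P (-s) :=
    ⟨_, fun _ => rfl⟩
  have hg0 : g 0 = 1 := by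
    have h1 : mgf (fun ω => (M 0 ω : ℝ)) P (-s) = mgf (fun _ => (0 : ℝ)) P (-s) :=
      mgf_congr hM.levy.start_zero
    simp [hg, h1]
  have hpow : ∀ (n : ℕ) (h : ℝ≥0), g (n * h) = g h ^ n := by
    intro n h
    induction n with
    | zero => simp [hg0]
    | succ n ih =>
      rw [pow_succ, ← ih, Nat.cast_succ, add_mul, one_mul]
      simp only [hg]
      exact hM.levy.mgf_add (-s) (n * h) h
  rw [show ∫ ω, Real.exp (-s * (M t ω : ℝ)) ∂P = g t from (hg t).symm]
  rcases eq_or_ne t 0 with rfl | ht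
  · simp [hg0]
  have ht0 : 0 < t := pos_iff_ne_zero.2 ht
  have hseq : Tendsto (fun n : ℕ => t / n) atTop (𝓝[>] 0) :=
    tendsto_nhdsWithin_iff.2 ⟨tendsto_const_div_atTop_nhds_zero_nat t, by
      filter_upwards [eventually_gt_atTop 0] with n hn
      exact div_pos ht0 (by exact_mod_cast hn)⟩
  have hlim : Tendsto (fun n : ℕ => (n : ℝ) * (g (t / n) - 1)) atTop
      (𝓝 (-gcpLaplaceExponent k rate s * (t : ℝ))) := by
    have h1 := ((hM.mgf_isLittleO hs).comp_tendsto hseq).tendsto_div_nhds_zero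
    have h2 := (h1.sub_const (gcpLaplaceExponent k rate s)).mul_const (t : ℝ)
    rw [zero_sub] at h2
    refine h2.congr' ?_
    filter_upwards [eventually_gt_atTop 0] with n hn
    have h3 : (t : ℝ) ≠ 0 := by exact_mod_cast ht
    have h4 : (n : ℝ) ≠ 0 := by exact_mod_cast hn.ne'
    simp only [Function.comp, NNReal.coe_div, NNReal.coe_natCast, hg]
    field_simp
    ring
  have hexp := Real.tendsto_one_add_pow_exp_of_tendsto hlim
  refine tendsto_nhds_unique (tendsto_const_nhds.congr' ?_) hexp
  filter_upwards [eventually_gt_atTop 0] with n hn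
  have h4 : (n : ℝ≥0) ≠ 0 := by exact_mod_cast hn.ne'
  rw [add_sub_cancel, ← hpow, mul_div_cancel₀ _ h4]

/-! ### Evaluation at an independent random time -/

/-- The point `(i + 1) / (n + 1)`. With `i = ⌊(n + 1) x⌋` it is the first point of the grid of
mesh `1 / (n + 1)` strictly above `x`. -/
noncomputable def gridAbove (n : ℕ) (i : ℕ) : ℝ≥0 := (i + 1) / (n + 1)

theorem tendsto_gridAbove_floor (x : ℝ≥0) :
    Tendsto (fun n : ℕ => gridAbove n ⌊((n : ℝ≥0) + 1) * x⌋₊) atTop (𝓝[≥] x) := by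
  have hlo : ∀ n : ℕ, x ≤ gridAbove n ⌊((n : ℝ≥0) + 1) * x⌋₊ := fun n => by
    rw [gridAbove, le_div_iff₀ (by positivity), mul_comm]
    exact (Nat.lt_floor_add_one _).le
  have hhi : ∀ n : ℕ, gridAbove n ⌊((n : ℝ≥0) + 1) * x⌋₊ ≤ x + 1 / (n + 1) := fun n => by
    have h1 : ((n : ℝ≥0) + 1) ≠ 0 := by positivity
    rw [gridAbove, add_div]
    gcongr
    rw [div_le_iff₀ (by positivity), mul_comm x]
    exact Nat.floor_le (by positivity)
  refine tendsto_nhdsWithin_iff.2 ⟨?_, Eventually.of_forall hlo⟩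
  have h1 : Tendsto (fun n : ℕ => x + 1 / ((n : ℝ≥0) + 1)) atTop (𝓝 x) := by
    simpa using (tendsto_one_div_add_atTop_nhds_zero_nat (𝕜 := ℝ≥0)).const_add x
  exact tendsto_of_tendsto_of_tendsto_of_le_of_le tendsto_const_nhds h1 hlo hhi

theorem gcpLaplaceExponent_nonneg {k : ℕ} {rate : ℕ → ℝ}
    (hrate : ∀ j ∈ Finset.Icc 1 k, 0 < rate j) {s : ℝ}
    (hs : 0 ≤ s) : 0 ≤ gcpLaplaceExponent k rate s :=
  Finset.sum_nonneg fun j hj => mul_nonneg (hrate j hj).le (sub_nonneg.2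
    (Real.exp_le_one_iff.2 (by have := Nat.cast_nonneg (α := ℝ) j; nlinarith)))

section TimeChange

variable {Ω : Type*} [MeasurableSpace Ω] {P : Measure Ω} {k : ℕ}
  {rate : ℕ → ℝ} {M : ℝ≥0 → Ω → ℕ} {T : Ω → ℝ≥0}

theorem IsGeneralizedCountingProcess.ae_tendsto_gridAbove
    (hM : IsGeneralizedCountingProcess k rate M P) (T : Ω → ℝ≥0) :
    ∀ᵐ ω ∂P, Tendsto (fun n : ℕ => (M (gridAbove n ⌊((n : ℝ≥0) + 1) * T ω⌋₊) ω : ℝ)) atTop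
      (𝓝 (M (T ω) ω : ℝ)) := by
  filter_upwards [hM.levy.cadlag] with ω hω
  exact (hω (T ω)).1.tendsto.comp (tendsto_gridAbove_floor (T ω))

theorem IsGeneralizedCountingProcess.measurable_comp_gridAbove
    (hM : IsGeneralizedCountingProcess k rate M P) (hT : Measurable T) (n : ℕ) :
    Measurable fun ω => (M (gridAbove n ⌊((n : ℝ≥0) + 1) * T ω⌋₊) ω : ℝ) := by
  have h1 : Measurable fun p : ℕ × Ω => (M (gridAbove n p.1) p.2 : ℝ) :=
    measurable_from_prod_countable_right fun i => hM.levy.measurable (gridAbove n i)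
  exact h1.comp (g := fun p : ℕ × Ω => (M (gridAbove n p.1) p.2 : ℝ))
    (f := fun ω => (⌊((n : ℝ≥0) + 1) * T ω⌋₊, ω))
    ((Nat.measurable_floor.comp (hT.const_mul _)).prodMk measurable_id)

/-- Right-continuity of the paths makes the process evaluated at a random time measurable up to a
null set, as a limit of its values at random grid points. -/
theorem IsGeneralizedCountingProcess.aemeasurable_comp
    (hM : IsGeneralizedCountingProcess k rate M P) (hT : Measurable T) :
    AEMeasurable (fun ω => (M (T ω) ω : ℝ)) P :=
  aemeasurable_of_tendsto_metrizable_ae'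
    (fun n => (hM.measurable_comp_gridAbove hT n).aemeasurable) (hM.ae_tendsto_gridAbove T)

variable [IsProbabilityMeasure P]

/-- Conditioning on a random time with countably many values `τ i`, by Fubini's theorem on the
product of path space and `ℕ`. -/
theorem IsGeneralizedCountingProcess.integral_exp_comp_nat
    (hM : IsGeneralizedCountingProcess k rate M P) {N : Ω → ℕ} (hN : Measurable N)
    (hMN : IndepFun (fun ω t => M t ω) N P) (τ : ℕ → ℝ≥0) {s : ℝ} (hs : 0 ≤ s) :
    ∫ ω, Real.exp (-s * (M (τ (N ω)) ω : ℝ)) ∂P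
      = ∫ ω, Real.exp (-gcpLaplaceExponent k rate s * (τ (N ω) : ℝ)) ∂P := by
  have hY : Measurable fun ω t => M t ω := measurable_pi_lambda _ hM.measurable
  have hF : Measurable fun p : (ℝ≥0 → ℕ) × ℕ => Real.exp (-s * (p.1 (τ p.2) : ℝ)) :=
    measurable_from_prod_countable_left fun i =>
      (measurable_of_countable fun m : ℕ => Real.exp (-s * (m : ℝ))).comp
        (measurable_pi_apply (τ i))
  have := Measure.isProbabilityMeasure_map hY.aemeasurable (μ := P)
  have := Measure.isProbabilityMeasure_map hN.aemeasurable (μ := P)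
  have h1 : ∫ ω, Real.exp (-s * (M (τ (N ω)) ω : ℝ)) ∂P
      = ∫ p, Real.exp (-s * (p.1 (τ p.2) : ℝ)) ∂(P.map fun ω => ((fun t => M t ω), N ω)) :=
    (integral_map (hY.prodMk hN).aemeasurable hF.aestronglyMeasurable).symm
  rw [h1, hMN.map_prod_eq_prod_map_map hY.aemeasurable hN.aemeasurable, integral_prod_symm,
    integral_map hN.aemeasurable (measurable_of_countable _).aestronglyMeasurable]
  · congr 1
    ext ω
    exact (integral_map hY.aemeasurable
      (hF.comp measurable_prodMk_right).aestronglyMeasurable).trans (hM.integral_exp hs (τ (N ω)))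
  · refine Integrable.of_bound hF.aestronglyMeasurable 1 (ae_of_all _ fun p => ?_)
    rw [Real.norm_of_nonneg (Real.exp_pos _).le]
    exact Real.exp_le_one_iff.2 (by
      have := Nat.cast_nonneg (α := ℝ) (p.1 (τ p.2)); nlinarith)

/-- Conditioning on an independent random time `T`: both sides are limits of the corresponding
expectations at random grid points converging to `T` from above. -/
theorem IsGeneralizedCountingProcess.integral_exp_comp
    (hM : IsGeneralizedCountingProcess k rate M P)
    (hrate : ∀ j ∈ Finset.Icc 1 k, 0 < rate j) (hT : Measurable T)
    (hMT : IndepFun (fun ω t => M t ω) T P) {s : ℝ} (hs : 0 ≤ s) :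
    ∫ ω, Real.exp (-s * (M (T ω) ω : ℝ)) ∂P
      = ∫ ω, Real.exp (-gcpLaplaceExponent k rate s * (T ω : ℝ)) ∂P := by
  have hψ := gcpLaplaceExponent_nonneg hrate hs
  have hbound : ∀ {c x : ℝ}, 0 ≤ c → 0 ≤ x → ‖Real.exp (-c * x)‖ ≤ 1 := fun hc hx => by
    rw [Real.norm_of_nonneg (Real.exp_pos _).le]
    exact Real.exp_le_one_iff.2 (by nlinarith)
  have hfl : ∀ n : ℕ, Measurable fun x : ℝ≥0 => ⌊((n : ℝ≥0) + 1) * x⌋₊ := fun n =>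
    Nat.measurable_floor.comp (measurable_const_mul _)
  have hL : Tendsto (fun n : ℕ => ∫ ω,
      Real.exp (-s * (M (gridAbove n ⌊((n : ℝ≥0) + 1) * T ω⌋₊) ω : ℝ)) ∂P) atTop
      (𝓝 (∫ ω, Real.exp (-s * (M (T ω) ω : ℝ)) ∂P)) := by
    refine tendsto_integral_of_dominated_convergence (fun _ => 1)
      (fun n => ?_) (integrable_const _) (fun n => ae_of_all _ fun ω => hbound hs (by positivity)) ?_
    · exact (((hM.measurable_comp_gridAbove hT n).const_mul _).exp).aestronglyMeasurable
    · filter_upwards [hM.ae_tendsto_gridAbove T] with ω hω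
      exact (Real.continuous_exp.tendsto _).comp (hω.const_mul (-s))
  have hR : Tendsto (fun n : ℕ => ∫ ω, Real.exp (-gcpLaplaceExponent k rate s *
      (gridAbove n ⌊((n : ℝ≥0) + 1) * T ω⌋₊ : ℝ)) ∂P) atTop
      (𝓝 (∫ ω, Real.exp (-gcpLaplaceExponent k rate s * (T ω : ℝ)) ∂P)) := by
    refine tendsto_integral_of_dominated_convergence (fun _ => 1)
      (fun n => ?_) (integrable_const _) (fun n => ae_of_all _ fun ω => hbound hψ (by positivity))
      (ae_of_all _ fun ω => ?_)
    · exact ((measurable_of_countable fun i : ℕ => Real.exp (-gcpLaplaceExponent k rate s *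
        (gridAbove n i : ℝ))).comp ((hfl n).comp hT)).aestronglyMeasurable
    · have h1 := (tendsto_gridAbove_floor (T ω)).mono_right nhdsWithin_le_nhds
      exact (Real.continuous_exp.tendsto _).comp ((NNReal.tendsto_coe.2 h1).const_mul _)
  refine tendsto_nhds_unique hL (hR.congr fun n => ?_)
  exact (hM.integral_exp_comp_nat ((hfl n).comp hT) (hMT.comp measurable_id (hfl n))
    (gridAbove n) hs).symm

end TimeChange

/-! ### Behaviour of the Laplace exponents at zero -/

theorem tendsto_gcpLaplaceExponent_div (k : ℕ) (rate : ℕ → ℝ) :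
    Tendsto (fun s => gcpLaplaceExponent k rate s / s) (𝓝[>] 0)
      (𝓝 (∑ j ∈ Finset.Icc 1 k, (j : ℝ) * rate j)) := by
  have h1 : HasDerivAt (gcpLaplaceExponent k rate)
      (∑ j ∈ Finset.Icc 1 k, (j : ℝ) * rate j) 0 := by
    refine HasDerivAt.fun_sum fun j _ => ?_
    have h2 := ((((hasDerivAt_id (0 : ℝ)).neg.mul_const (j : ℝ)).exp.const_sub 1).const_mul (rate j))
    refine h2.congr_deriv ?_
    simp [mul_comm]
  have h3 := h1.tendsto_slope_zero_right
  refine h3.congr fun s => ?_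
  simp [gcpLaplaceExponent, div_eq_inv_mul]

theorem gcpLaplaceExponent_pos {k : ℕ} (hk : 1 ≤ k) {rate : ℕ → ℝ}
    (hrate : ∀ j ∈ Finset.Icc 1 k, 0 < rate j) {s : ℝ} (hs : 0 < s) :
    0 < gcpLaplaceExponent k rate s := by
  refine Finset.sum_pos (fun j hj => mul_pos (hrate j hj) (sub_pos.2
    (Real.exp_lt_one_iff.2 ?_))) ⟨1, by simp [hk]⟩
  have : (0 : ℝ) < j := by exact_mod_cast (Finset.mem_Icc.1 hj).1
  nlinarith [mul_pos hs this]

theorem lowerIncompleteGamma_bounds {a x : ℝ} (ha : 0 < a) (hx : 0 ≤ x) :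
    Real.exp (-x) * (x ^ a / a) ≤ lowerIncompleteGamma a x ∧
      lowerIncompleteGamma a x ≤ x ^ a / a := by
  have hval : ∫ u in (0 : ℝ)..x, u ^ (a - 1) = x ^ a / a := by
    rw [integral_rpow (Or.inl (by linarith))]
    simp [Real.zero_rpow ha.ne']
  have hint : IntervalIntegrable (fun u : ℝ => u ^ (a - 1)) volume 0 x :=
    intervalIntegral.intervalIntegrable_rpow' (by linarith)
  have hint' : IntervalIntegrable (fun u : ℝ => Real.exp (-u) * u ^ (a - 1)) volume 0 x :=
    hint.continuousOn_mul (by fun_prop)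
  rw [← hval, ← intervalIntegral.integral_const_mul, lowerIncompleteGamma]
  constructor
  · refine intervalIntegral.integral_mono_on hx (hint.const_mul _) hint' fun u hu => ?_
    have := Real.rpow_nonneg hu.1 (a - 1)
    have := Real.exp_le_exp.2 (neg_le_neg hu.2)
    gcongr
  · refine intervalIntegral.integral_mono_on hx hint' hint fun u hu => ?_
    exact mul_le_of_le_one_left (Real.rpow_nonneg hu.1 _)
      (Real.exp_le_one_iff.2 (neg_nonpos.2 hu.1))

theorem tendsto_incompleteGammaExponent_div_rpow {α ε : ℝ} (hα : 0 < α) (hε : 0 < ε) :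
    Tendsto (fun η => α * ε ^ (-α) * lowerIncompleteGamma α (η * ε) / η ^ α) (𝓝[>] 0) (𝓝 1) := by
  have h1 : Tendsto (fun η : ℝ => Real.exp (-(η * ε))) (𝓝[>] 0) (𝓝 1) := by
    have : Continuous fun η : ℝ => Real.exp (-(η * ε)) := by fun_prop
    simpa using (this.tendsto 0).mono_left nhdsWithin_le_nhds
  have hscale : ∀ η : ℝ, 0 < η → ∀ z : ℝ,
      α * ε ^ (-α) * (z * ((η * ε) ^ α / α)) / η ^ α = z := fun η hη z => by
    rw [Real.mul_rpow hη.le hε.le, Real.rpow_neg hε.le]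
    have : 0 < η ^ α := by positivity
    have : 0 < ε ^ α := by positivity
    field_simp
  refine tendsto_of_tendsto_of_tendsto_of_le_of_le' h1 tendsto_const_nhds ?_ ?_
  · filter_upwards [self_mem_nhdsWithin] with η (hη : 0 < η)
    have h2 := (lowerIncompleteGamma_bounds hα (by positivity : 0 ≤ η * ε)).1
    calc Real.exp (-(η * ε))
        = α * ε ^ (-α) * (Real.exp (-(η * ε)) * ((η * ε) ^ α / α)) / η ^ α :=
          (hscale η hη _).symm
      _ ≤ _ := by gcongr
  · filter_upwards [self_mem_nhdsWithin] with η (hη : 0 < η)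
    have h2 := (lowerIncompleteGamma_bounds hα (by positivity : 0 ≤ η * ε)).2
    calc _ ≤ α * ε ^ (-α) * (1 * ((η * ε) ^ α / α)) / η ^ α := by rw [one_mul]; gcongr
      _ = 1 := hscale η hη 1

/-- If `φ η ~ η ^ α` and `ψ s ~ c s` at `0+`, then `1 - exp (-t φ (ψ s))` is asymptotic to
`t c ^ α s ^ α`. -/
theorem tendsto_one_sub_exp_div_rpow {φ ψ : ℝ → ℝ} {α c t : ℝ} (hα : 0 < α)
    (hφ : Tendsto (fun η => φ η / η ^ α) (𝓝[>] 0) (𝓝 1))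
    (hψ0 : ∀ s, 0 < s → 0 < ψ s) (hψ : Tendsto (fun s => ψ s / s) (𝓝[>] 0) (𝓝 c)) :
    Tendsto (fun s => (1 - Real.exp (-t * φ (ψ s))) / s ^ α) (𝓝[>] 0) (𝓝 (t * c ^ α)) := by
  have hid : Tendsto (fun s : ℝ => s) (𝓝[>] 0) (𝓝 0) := nhdsWithin_le_nhds
  have hψlim : Tendsto ψ (𝓝[>] 0) (𝓝[>] 0) := by
    refine tendsto_nhdsWithin_iff.2 ⟨?_, ?_⟩
    · have := hψ.mul hid
      rw [mul_zero] at this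
      refine this.congr' ?_
      filter_upwards [self_mem_nhdsWithin] with s (hs : 0 < s) using div_mul_cancel₀ _ hs.ne'
    · filter_upwards [self_mem_nhdsWithin] with s hs using hψ0 s hs
  have hφlim : Tendsto φ (𝓝[>] 0) (𝓝[≠] 0) := by
    refine tendsto_nhdsWithin_iff.2 ⟨?_, ?_⟩
    · have h1 : Tendsto (fun η : ℝ => η ^ α) (𝓝[>] 0) (𝓝 0) := by
        simpa [Real.zero_rpow hα.ne'] using hid.rpow_const (Or.inr hα.le)
      have := hφ.mul h1
      rw [mul_zero] at this
      refine this.congr' ?_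
      filter_upwards [self_mem_nhdsWithin] with η (hη : 0 < η)
      exact div_mul_cancel₀ _ (Real.rpow_pos_of_pos hη α).ne'
    · filter_upwards [hφ.eventually_ne one_ne_zero] with η hη h0
      exact hη (by rw [h0, zero_div])
  have hexp : Tendsto (fun u : ℝ => (1 - Real.exp (-t * u)) / u) (𝓝[≠] 0) (𝓝 t) := by
    have h1 : HasDerivAt (fun u => 1 - Real.exp (-t * u)) t 0 := by
      refine (((hasDerivAt_id (0 : ℝ)).const_mul (-t)).exp.const_sub 1).congr_deriv ?_
      simp
    refine h1.tendsto_slope_zero.congr fun u => ?_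
    simp [div_eq_inv_mul]
  have hmain := ((hexp.comp (hφlim.comp hψlim)).mul (hφ.comp hψlim)).mul
    (hψ.rpow_const (p := α) (Or.inr hα.le))
  rw [mul_one] at hmain
  refine hmain.congr' ?_
  filter_upwards [self_mem_nhdsWithin, (hφlim.comp hψlim).eventually self_mem_nhdsWithin]
    with s (hs : 0 < s) (h0 : φ (ψ s) ≠ 0)
  have h1 := hψ0 s hs
  have h2 : 0 < s ^ α := by positivity
  have h3 : 0 < ψ s ^ α := by positivity
  simp only [Function.comp]
  rw [Real.div_rpow h1.le hs.le]
  field_simp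

/-! ### The tail of the time-changed process -/

theorem mainTheorem9 {Ω : Type*} [MeasurableSpace Ω] (P : Measure Ω) [IsProbabilityMeasure P]
    (k : ℕ) (hk : 1 ≤ k) (rate : ℕ → ℝ) (hrate : ∀ j ∈ Finset.Icc 1 k, 0 < rate j)
    (α : ℝ) (hα0 : 0 < α) (hα1 : α < 1) (ε : ℝ) (hε : 0 < ε)
    (M : ℝ≥0 → Ω → ℕ) (hM : IsGeneralizedCountingProcess k rate M P)
    (G : ℝ≥0 → Ω → ℝ≥0) (hG : IsIncompleteGammaSubordinator α ε G P)
    (hMG : IndepFun (fun ω t => M t ω) (fun ω t => G t ω) P)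
    (t : ℝ≥0) :
    (fun y : ℝ => P.real {ω | y < (timeChange M G t ω : ℝ)})
      ~[atTop]
    (fun y : ℝ => (t : ℝ) * (∑ j ∈ Finset.Icc 1 k, (j : ℝ) * rate j) ^ α * y ^ (-α)
      / Real.Gamma (1 - α)) := by
  -- for `t = 0` equivalence to the zero function means being eventually equal to it
  rcases eq_or_ne t 0 with rfl | ht
  · have h0 : ∀ᵐ ω ∂P, timeChange M G 0 ω = 0 := by
      filter_upwards [hM.levy.start_zero, hG.subordinator.levy.start_zero] with ω h1 h2
      have h3 : G 0 ω = 0 := by exact_mod_cast h2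
      rw [timeChange, h3]
      exact_mod_cast h1
    refine EventuallyEq.isEquivalent ?_
    filter_upwards [eventually_ge_atTop 0] with y hy
    have h1 : P {ω | y < (timeChange M G 0 ω : ℝ)} = 0 := by
      refine measure_mono_null (t := {ω | ¬timeChange M G 0 ω = 0})
        (fun ω (hω : y < _) (h2 : timeChange M G 0 ω = 0) => ?_) h0
      rw [h2, Nat.cast_zero] at hω
      exact hω.not_ge hy
    simp [Measure.real, h1]
  have hGm : Measurable (G t) := by
    have h1 := (hG.subordinator.levy.measurable t).real_toNNReal
    simpa only [Real.toNNReal_coe] using h1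
  have hind : IndepFun (fun ω t => M t ω) (G t) P :=
    hMG.comp measurable_id (measurable_pi_apply t)
  set φ : ℝ → ℝ := fun η => α * ε ^ (-α) * lowerIncompleteGamma α (η * ε) with hφ
  set ψ : ℝ → ℝ := gcpLaplaceExponent k rate with hψ
  set c := ∑ j ∈ Finset.Icc 1 k, (j : ℝ) * rate j with hc
  have hlap : ∀ s : ℝ, 0 < s → ∫ x in Set.Ioi (0 : ℝ), Real.exp (-(s * x)) *
      P.real {ω | x < (timeChange M G t ω : ℝ)}
      = (1 - Real.exp (-(t : ℝ) * φ (ψ s))) / s := fun s hs => by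
    rw [← hG.laplace t (ψ s) (gcpLaplaceExponent_pos hk hrate hs),
      ← hM.integral_exp_comp hrate hGm hind hs.le]
    exact integral_exp_mul_measureReal_gt (hM.aemeasurable_comp hGm)
      (fun ω => Nat.cast_nonneg _) hs
  have hanti : Antitone fun x : ℝ => P.real {ω | x < (timeChange M G t ω : ℝ)} :=
    fun a b hab => measureReal_mono fun ω (hω : b < _) => hab.trans_lt hω
  have hint : ∀ s : ℝ, 0 < s → IntegrableOn (fun x => Real.exp (-(s * x)) *
      P.real {ω | x < (timeChange M G t ω : ℝ)}) (Set.Ioi 0) := fun s hs => by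
    refine Integrable.mul_bdd (c := 1) ?_ hanti.measurable.aestronglyMeasurable
      (ae_of_all _ fun x => ?_)
    · simpa only [neg_mul, IntegrableOn] using integrableOn_exp_mul_Ioi (neg_neg_of_pos hs) 0
    · rw [Real.norm_of_nonneg measureReal_nonneg]
      exact measureReal_le_one
  have hlim : Tendsto (fun s : ℝ => s ^ (1 - α) * ∫ x in Set.Ioi (0 : ℝ), Real.exp (-(s * x)) *
      P.real {ω | x < (timeChange M G t ω : ℝ)}) (𝓝[>] 0) (𝓝 (t * c ^ α)) := by
    refine (tendsto_one_sub_exp_div_rpow (t := t) hα0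
      (tendsto_incompleteGammaExponent_div_rpow hα0 hε)
      (fun s hs => gcpLaplaceExponent_pos hk hrate hs)
      (tendsto_gcpLaplaceExponent_div k rate)).congr' ?_
    filter_upwards [self_mem_nhdsWithin] with s (hs : 0 < s)
    rw [hlap s hs, Real.rpow_sub hs, Real.rpow_one]
    simp only [hφ, hψ]
    have : 0 < s ^ α := by positivity
    field_simp
  have htail := tendsto_rpow_mul_of_tendsto_laplace (sub_pos.2 hα1) (by linarith)
    (fun x _ => measureReal_nonneg) (hanti.antitoneOn _) hint hlim
  rw [sub_sub_cancel] at htail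
  have hc0 : 0 < c := Finset.sum_pos (fun j hj => mul_pos
    (by exact_mod_cast (Finset.mem_Icc.1 hj).1) (hrate j hj)) ⟨1, by simp [hk]⟩
  have ht0 : (0 : ℝ) < t := by exact_mod_cast pos_iff_ne_zero.2 ht
  have hΓ : 0 < Real.Gamma (1 - α) := Real.Gamma_pos_of_pos (sub_pos.2 hα1)
  have hK : 0 < t * c ^ α / Real.Gamma (1 - α) := by positivity
  refine isEquivalent_of_tendsto_one ?_
  have hdiv := htail.div_const (t * c ^ α / Real.Gamma (1 - α))
  rw [div_self hK.ne'] at hdiv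
  refine hdiv.congr' ?_
  filter_upwards [eventually_gt_atTop 0] with y hy
  have : 0 < y ^ α := by positivity
  have : 0 < c ^ α := by positivity
  simp only [Pi.div_apply]
  rw [Real.rpow_neg hy.le]
  field_simp
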